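/- Let $\mu^-,\mu^+$ be Borel probability measures on $\mathbb{R}^d$ with compact supports $X^-,X^+$, and let $c:X^-\times X^+\to\mathbb{R}$ be continuous. Let $\Pi(\mu^-,\mu^+)$ be the set of couplings, i.e. of probability measures on $\mathbb{R}^d\times\mathbb{R}^d$ with marginals $\mu^-$ and $\mu^+$. For $\gamma\in\Pi(\mu^-,\mu^+)$ let $\mathrm{Ent}(\gamma\,|\,\mu^-\otimes\mu^+)\in[0,+\infty]$ be the relative entropy, equal to $\int\rho\log\rho\,\mathrm{d}(\mu^-\otimes\mu^+)$ if $\gamma=\rho\,(\mu^-\otimes\mu^+)$ and to $+\infty$ if $\gamma$ is not absolutely continuous with respect to $\mu^-\otimes\mu^+$. For $\varepsilon>0$ let $$v_\varepsilon=\inf_{\gamma\in\Pi(\mu^-,\mu^+)}\Big\{\int_{X^-\times X^+} c\,\mathrm{d}\gamma+\varepsilon\,\mathrm{Ent}(\gamma\,|\,\mu^-\otimes\mu^+)\Big\},\qquad v_0=\inf_{\gamma\in\Pi(\mu^-,\mu^+)}\int_{X^-\times X^+} c\,\mathrm{d}\gamma,$$ and let $\mathsf{Opt}(\mu^-,\mu^+)$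 be the set of minimizers in the problem defining $v_0$. All these values $v_\varepsilon$, $\varepsilon\ge 0$, are finite, and for every $\varepsilon>0$ the problem defining $v_\varepsilon$ has a unique minimizer $\gamma_\varepsilon$. Then: 1. For every $\varepsilon>0$, $\mathrm{Ent}(\gamma_\varepsilon\,|\,\mu^-\otimes\mu^+)<+\infty$, and $\varepsilon\mapsto v_\varepsilon$ is differentiable at $\varepsilon$ with $v_\varepsilon'=\mathrm{Ent}(\gamma_\varepsilon\,|\,\mu^-\otimes\mu^+)$. 2. Suppose that some $\gamma_0\in\mathsf{Opt}(\mu^-,\mu^+)$ satisfies $\mathrm{Ent}(\gamma_0\,|\,\mu^-\otimes\mu^+)<+\infty$. Then $\varepsilon\mapsto v_\varepsilon$ belongs to $\mathscr{C}^1([0,+\infty))$, its right derivative at $0$ is $$v_\varepsilon'|_{\varepsilon=0}=\inf_{\gamma\in\mathsf{Opt}(\mu^-,\mu^+)}\mathrm{Ent}(\gamma\,|\,\mu^-\otimes\mu^+)<+\infty,$$ and, as $\varepsilon\downarrow0$, $$v_\varepsilon-v_0=\varepsilon\inf_{\gamma\in\mathsf{Opt}(\mu^-,\mu^+)}\mathrm{Ent}(\gamma\,|\,\mu^-\otimes\mu^+)+o(\varepsilon).$$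 Moreover there is a unique $\gamma^\ast\in\mathsf{Opt}(\mu^-,\mu^+)$ minimizing $\mathrm{Ent}(\cdot\,|\,\mu^-\otimes\mu^+)$ over $\mathsf{Opt}(\mu^-,\mu^+)$, and $\gamma_\varepsilon$ converges narrowly to $\gamma^\ast$ as $\varepsilon\downarrow0$. -/

import Mathlib

open MeasureTheory Set Filter Topology Asymptotics
open scoped ENNReal

namespace EntropicOT

/-- The couplings `Π(μ, ν)`: probability measures on `ℝᵈ × ℝᵈ` with marginals `μ` and `ν`. -/
def couplings {d : ℕ} (μ ν : Measure (EuclideanSpace ℝ (Fin d))) :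
    Set (ProbabilityMeasure (EuclideanSpace ℝ (Fin d) × EuclideanSpace ℝ (Fin d))) :=
  {γ | (γ : Measure (EuclideanSpace ℝ (Fin d) × EuclideanSpace ℝ (Fin d))).fst = μ ∧
    (γ : Measure (EuclideanSpace ℝ (Fin d) × EuclideanSpace ℝ (Fin d))).snd = ν}

/-- The Boltzmann-Shannon relative entropy `Ent(γ | μ ⊗ ν) ∈ [0, ∞]`. -/
noncomputable def ent {d : ℕ} (μ ν : Measure (EuclideanSpace ℝ (Fin d)))
    (γ : ProbabilityMeasure (EuclideanSpace ℝ (Fin d) × EuclideanSpace ℝ (Fin d))) : ℝ≥0∞ :=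
  InformationTheory.klDiv
    (γ : Measure (EuclideanSpace ℝ (Fin d) × EuclideanSpace ℝ (Fin d))) (μ.prod ν)

/-- The transport cost `∫ c dγ` of a plan. The cost `c` only matters on `spt μ × spt ν`, where
every coupling is concentrated. -/
noncomputable def transportCost {d : ℕ} (μ ν : Measure (EuclideanSpace ℝ (Fin d)))
    (c : EuclideanSpace ℝ (Fin d) × EuclideanSpace ℝ (Fin d) → ℝ)
    (γ : ProbabilityMeasure (EuclideanSpace ℝ (Fin d) × EuclideanSpace ℝ (Fin d))) : ℝ :=
  ∫ p in μ.support ×ˢ ν.support, c p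
    ∂(γ : Measure (EuclideanSpace ℝ (Fin d) × EuclideanSpace ℝ (Fin d)))

/-- The functional `∫ c dγ + ε Ent(γ | μ ⊗ ν)`, with values in the extended reals. At `ε = 0` the
convention `0 * ∞ = 0` of `EReal` makes it the plain transport cost. -/
noncomputable def entropicFunctional {d : ℕ} (μ ν : Measure (EuclideanSpace ℝ (Fin d)))
    (c : EuclideanSpace ℝ (Fin d) × EuclideanSpace ℝ (Fin d) → ℝ) (ε : ℝ)
    (γ : ProbabilityMeasure (EuclideanSpace ℝ (Fin d) × EuclideanSpace ℝ (Fin d))) : EReal :=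
  (transportCost μ ν c γ : EReal) + (ε : EReal) * (ent μ ν γ : EReal)

theorem entropicFunctional_zero {d : ℕ} (μ ν : Measure (EuclideanSpace ℝ (Fin d)))
    (c : EuclideanSpace ℝ (Fin d) × EuclideanSpace ℝ (Fin d) → ℝ)
    (γ : ProbabilityMeasure (EuclideanSpace ℝ (Fin d) × EuclideanSpace ℝ (Fin d))) :
    entropicFunctional μ ν c 0 γ = (transportCost μ ν c γ : EReal) := by
  simp [entropicFunctional]

/-- The infimum of the functional over all couplings, in the extended reals. -/
noncomputable def entropicInf {d : ℕ} (μ ν : Measure (EuclideanSpace ℝ (Fin d)))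
    (c : EuclideanSpace ℝ (Fin d) × EuclideanSpace ℝ (Fin d) → ℝ) (ε : ℝ) : EReal :=
  ⨅ γ ∈ couplings μ ν, entropicFunctional μ ν c ε γ

/-- The entropic cost `v_ε` (the transport cost `v_0` for `ε = 0`), as a real number. -/
noncomputable def entropicCost {d : ℕ} (μ ν : Measure (EuclideanSpace ℝ (Fin d)))
    (c : EuclideanSpace ℝ (Fin d) × EuclideanSpace ℝ (Fin d) → ℝ) (ε : ℝ) : ℝ :=
  (entropicInf μ ν c ε).toReal

/-- The set `Opt(μ, ν)` of optimal transport plans. -/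
def optimalPlans {d : ℕ} (μ ν : Measure (EuclideanSpace ℝ (Fin d)))
    (c : EuclideanSpace ℝ (Fin d) × EuclideanSpace ℝ (Fin d) → ℝ) :
    Set (ProbabilityMeasure (EuclideanSpace ℝ (Fin d) × EuclideanSpace ℝ (Fin d))) :=
  {γ | γ ∈ couplings μ ν ∧ IsMinOn (transportCost μ ν c) (couplings μ ν) γ}

/-- The set of minimizers of the entropic problem with parameter `ε`. -/
def entropicPlans {d : ℕ} (μ ν : Measure (EuclideanSpace ℝ (Fin d)))
    (c : EuclideanSpace ℝ (Fin d) × EuclideanSpace ℝ (Fin d) → ℝ) (ε : ℝ) :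
    Set (ProbabilityMeasure (EuclideanSpace ℝ (Fin d) × EuclideanSpace ℝ (Fin d))) :=
  {γ | γ ∈ couplings μ ν ∧ IsMinOn (entropicFunctional μ ν c ε) (couplings μ ν) γ}

/-- The infimum of the entropy over the optimal transport plans, in `[0, ∞]`. -/
noncomputable def minEnt {d : ℕ} (μ ν : Measure (EuclideanSpace ℝ (Fin d)))
    (c : EuclideanSpace ℝ (Fin d) × EuclideanSpace ℝ (Fin d) → ℝ) : ℝ≥0∞ :=
  ⨅ γ ∈ optimalPlans μ ν c, ent μ ν γ

end EntropicOT

/-! Write `T` for the transport cost and `H` for the entropy. For `ε > 0` only couplings of finite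
entropy compete, and they are identified with their densities in `L¹(μ ⊗ ν)`. Everything rests on
the uniform convexity of `H` there: if `m` is the midpoint of `x` and `y`, then `‖x - y‖₁² ≤ 16 ((H
x + H y) / 2 - H m)` (`klFun_midpoint_gap`, `sq_dist_densityL1_le`). Since `T` is affine,
near-minimizers of `T + ε H` are close to one another. Minimizing sequences are thus Cauchy, Fatou's
lemma makes their limits minimizers, and uniqueness is the case of zero distance: completeness of
`L¹` replaces tightness and weak compactness.

For the derivative, testing the problem at `t` with the minimizer at `s` gives `v t - v s ≤ (t - s)
H (g s)`. Exchanging `s` and `t` shows that `H ∘ g` is antitone and traps the slopes of `v` between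
values of `H ∘ g`; the same convexity estimate makes `H ∘ g` continuous, so it is the derivative.

As `ε ↓ 0`, an optimal plan of finite entropy bounds the increasing entropies. Their convergence,
with uniform convexity, forces `g ε` to converge in `L¹`, and the limit is the optimal plan of least
entropy (`exists_limit_zero`). -/

/-- A perturbed minimisation problem `T + ε H` on `K`, where `K` is embedded by `e` in a metric
space, `T` is affine and Lipschitz, and `H` is lower semicontinuous and uniformly convex. -/
structure PerturbedProblem {X E : Type*} [MetricSpace E] (K : Set X) (e : X → E) (T H : X → ℝ)
    (M : ℝ) : Prop where
  nonneg : ∀ x ∈ K, 0 ≤ H x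
  bdd : ∀ x ∈ K, |T x| ≤ M
  lip : ∀ x ∈ K, ∀ y ∈ K, |T x - T y| ≤ M * dist (e x) (e y)
  inj : InjOn e K
  mid : ∀ x ∈ K, ∀ y ∈ K, ∃ m ∈ K, T m = (T x + T y) / 2 ∧
    dist (e x) (e y) ^ 2 ≤ 16 * ((H x + H y) / 2 - H m)
  closed : ∀ (u : ℕ → X), (∀ n, u n ∈ K) → ∀ f, Tendsto (fun n => e (u n)) atTop (𝓝 f) →
    ∀ B, Tendsto (fun n => H (u n)) atTop (𝓝 B) → ∃ x ∈ K, e x = f ∧ H x ≤ B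
  exists_zero : ∃ x ∈ K, H x = 0

/-! ### Abstract perturbed problem: existence and uniqueness of minimizers. -/

namespace PerturbedProblem

variable {X E : Type*} [MetricSpace E] {K : Set X} {e : X → E} {T H : X → ℝ} {M : ℝ}

theorem tendsto_cost (P : PerturbedProblem K e T H M) {ι : Type*} {l : Filter ι} {u : ι → X}
    (hu : ∀ᶠ i in l, u i ∈ K) {x : X} (hx : x ∈ K)
    (h : Tendsto (fun i => e (u i)) l (𝓝 (e x))) : Tendsto (fun i => T (u i)) l (𝓝 (T x)) := by
  rw [tendsto_iff_dist_tendsto_zero] at h ⊢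
  refine squeeze_zero' (.of_forall fun _ => dist_nonneg) ?_ (by simpa using h.const_mul M)
  filter_upwards [hu] with i hi
  exact P.lip _ hi _ hx

theorem tendsto_of_sq_dist_le {ι : Type*} {l : Filter ι} {z : ι → E} {a : E} {b : ι → ℝ}
    (h : ∀ᶠ i in l, dist (z i) a ^ 2 ≤ b i) (hb : Tendsto b l (𝓝 0)) : Tendsto z l (𝓝 a) := by
  rw [tendsto_iff_dist_tendsto_zero]
  have h2 : Tendsto (fun i => dist (z i) a ^ 2) l (𝓝 0) :=
    squeeze_zero' (.of_forall fun _ => sq_nonneg _) h hb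
  simpa [Real.sqrt_sq dist_nonneg] using h2.sqrt

theorem cauchySeq_of_sq_dist_le {z : ℕ → E} {b : ℕ → ℝ}
    (h : ∀ m n, m ≤ n → dist (z m) (z n) ^ 2 ≤ b m) (hb : Tendsto b atTop (𝓝 0)) :
    CauchySeq z := by
  refine cauchySeq_of_le_tendsto_0' (fun n => √(b n)) (fun m n hmn => ?_)
    (by simpa using hb.sqrt)
  exact Real.le_sqrt_of_sq_le (h m n hmn)

theorem exists_limit [CompleteSpace E] (P : PerturbedProblem K e T H M) {u : ℕ → X}
    (hu : ∀ n, u n ∈ K) {b : ℕ → ℝ} (h : ∀ m n, m ≤ n → dist (e (u m)) (e (u n)) ^ 2 ≤ b m)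
    (hb : Tendsto b atTop (𝓝 0)) {B : ℝ} {ε : ℝ} (hε : 0 < ε)
    (hB : Tendsto (fun n => T (u n) + ε * H (u n)) atTop (𝓝 B)) :
    ∃ x ∈ K, Tendsto (fun n => e (u n)) atTop (𝓝 (e x)) ∧ T x + ε * H x ≤ B := by
  have hc := cauchySeq_of_sq_dist_le h hb
  obtain ⟨f, hf⟩ := cauchySeq_tendsto_of_complete hc
  have hT : CauchySeq fun n => T (u n) := by
    rw [Metric.cauchySeq_iff] at hc ⊢
    intro δ hδ
    have hM : 0 ≤ M := (abs_nonneg _).trans (P.bdd _ (hu 0))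
    obtain ⟨N, hN⟩ := hc (δ / (M + 1)) (by positivity)
    refine ⟨N, fun m hm n hn => (P.lip _ (hu m) _ (hu n)).trans_lt ?_⟩
    have := hN m hm n hn
    rw [lt_div_iff₀ (by positivity)] at this
    nlinarith [dist_nonneg (x := e (u m)) (y := e (u n))]
  obtain ⟨τ, hτ⟩ := cauchySeq_tendsto_of_complete hT
  -- `closed` needs the entropies themselves to converge; they do because `T` is Lipschitz and `H`
  -- is the quotient of (value minus `T`) by `ε`.
  have hH : Tendsto (fun n => H (u n)) atTop (𝓝 ((B - τ) / ε)) := by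
    refine ((hB.sub hτ).div_const ε).congr fun n => ?_
    field_simp; ring
  obtain ⟨x, hx, rfl, hle⟩ := P.closed u hu f hf _ hH
  refine ⟨x, hx, hf, ?_⟩
  have := tendsto_nhds_unique hτ (P.tendsto_cost (.of_forall hu) hx hf)
  rw [le_div_iff₀ hε] at hle
  linarith

/-- The midpoint of `x` and `y` has value at least `v`, while `mid` puts it below the average value
by at least `ε / 16` times the squared distance. -/
theorem sq_dist_le (P : PerturbedProblem K e T H M) {ε v : ℝ} (hε : 0 < ε)
    (hv : ∀ x ∈ K, v ≤ T x + ε * H x) {x y : X} (hx : x ∈ K) (hy : y ∈ K) :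
    dist (e x) (e y) ^ 2 ≤
      16 / ε * ((T x + ε * H x + (T y + ε * H y)) / 2 - v) := by
  obtain ⟨m, hm, hT, hd⟩ := P.mid x hx y hy
  have := hv m hm
  rw [div_mul_eq_mul_div, le_div_iff₀ hε]
  nlinarith [mul_le_mul_of_nonneg_left hd hε.le]

theorem exists_minimizer [CompleteSpace E] (P : PerturbedProblem K e T H M) {ε : ℝ}
    (hε : 0 < ε) : ∃ x ∈ K, ∀ y ∈ K, T x + ε * H x ≤ T y + ε * H y := by
  set F : X → ℝ := fun x => T x + ε * H x with hF
  obtain ⟨x₀, hx₀, -⟩ := P.exists_zero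
  have hbb : BddBelow (F '' K) := by
    refine ⟨-M, ?_⟩
    rintro _ ⟨x, hx, rfl⟩
    have := (abs_le.1 (P.bdd x hx)).1
    have := mul_nonneg hε.le (P.nonneg x hx)
    show -M ≤ T x + ε * H x
    linarith
  have hv : ∀ x ∈ K, sInf (F '' K) ≤ F x := fun x hx => csInf_le hbb ⟨x, hx, rfl⟩
  obtain ⟨w, hwa, hw, hwm⟩ := exists_seq_tendsto_sInf (S := F '' K) ⟨_, x₀, hx₀, rfl⟩ hbb
  choose u huK hu using hwm
  have hb : Tendsto (fun n => 16 / ε * (w n - sInf (F '' K))) atTop (𝓝 0) := by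
    simpa using (hw.sub_const (sInf (F '' K))).const_mul (16 / ε)
  have hd : ∀ m n, m ≤ n → dist (e (u m)) (e (u n)) ^ 2 ≤ 16 / ε * (w m - sInf (F '' K)) := by
    intro m n hmn
    refine (P.sq_dist_le hε hv (huK m) (huK n)).trans ?_
    have h1 : T (u m) + ε * H (u m) = w m := hu m
    have h2 : T (u n) + ε * H (u n) = w n := hu n
    rw [h1, h2]
    have := hwa hmn
    gcongr
    linarith
  obtain ⟨x, hx, -, hle⟩ := P.exists_limit huK hd hb hε (hw.congr fun n => (hu n).symm)
  exact ⟨x, hx, fun y hy => hle.trans (hv y hy)⟩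

theorem eq_of_isMinOn (P : PerturbedProblem K e T H M) {ε : ℝ} (hε : 0 < ε) {x y : X}
    (hx : x ∈ K) (hy : y ∈ K) (hmx : ∀ z ∈ K, T x + ε * H x ≤ T z + ε * H z)
    (hle : T y + ε * H y ≤ T x + ε * H x) : y = x := by
  refine P.inj hy hx (dist_le_zero.1 ?_)
  have h := P.sq_dist_le hε hmx hy hx
  have h2 : 16 / ε * ((T y + ε * H y + (T x + ε * H x)) / 2 - (T x + ε * H x)) ≤ 0 :=
    mul_nonpos_of_nonneg_of_nonpos (by positivity) (by linarith)
  nlinarith [dist_nonneg (x := e y) (y := e x)]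

/-! ### Dependence of the minimizers on the parameter, and the limit at zero. -/

section Selection

variable {g : ℝ → X}

/-- Envelope inequality: the minimizer at `s` is a competitor at `t`. -/
theorem slope_le (hgK : ∀ ε, 0 < ε → g ε ∈ K)
    (hg : ∀ ε, 0 < ε → ∀ y ∈ K, T (g ε) + ε * H (g ε) ≤ T y + ε * H y) {s t : ℝ}
    (hs : 0 < s) (ht : 0 < t) :
    T (g t) + t * H (g t) - (T (g s) + s * H (g s)) ≤ (t - s) * H (g s) := by
  have := hg t ht _ (hgK s hs)
  linarith

theorem antitone_entropy (hgK : ∀ ε, 0 < ε → g ε ∈ K)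
    (hg : ∀ ε, 0 < ε → ∀ y ∈ K, T (g ε) + ε * H (g ε) ≤ T y + ε * H y) {s t : ℝ}
    (hs : 0 < s) (hst : s ≤ t) : H (g t) ≤ H (g s) := by
  rcases hst.eq_or_lt with rfl | hst
  · rfl
  have h1 := slope_le hgK hg hs (hs.trans hst)
  have h2 := slope_le hgK hg (hs.trans hst) hs
  nlinarith

/-- By `slope_le`, `g t` exceeds the minimum at `ε` by at most `(t - ε) (H (g ε) - H (g t))`. For `t
> ε / 2` monotonicity bounds both entropies by `H (g (ε / 2))`, so the excess tends to zero and
`sq_dist_le` applies. -/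
theorem tendsto_minimizer (P : PerturbedProblem K e T H M) (hgK : ∀ ε, 0 < ε → g ε ∈ K)
    (hg : ∀ ε, 0 < ε → ∀ y ∈ K, T (g ε) + ε * H (g ε) ≤ T y + ε * H y) {ε : ℝ} (hε : 0 < ε) :
    Tendsto (fun t => e (g t)) (𝓝 ε) (𝓝 (e (g ε))) := by
  have hpos : ∀ᶠ t in 𝓝 ε, ε / 2 < t := lt_mem_nhds (by linarith)
  refine tendsto_of_sq_dist_le (b := fun t => 16 / ε * (|t - ε| * H (g (ε / 2)))) ?_ ?_
  · filter_upwards [hpos] with t ht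
    have ht0 : 0 < t := by linarith
    refine (P.sq_dist_le hε (hg ε hε) (hgK t ht0) (hgK ε hε)).trans ?_
    have h1 := slope_le hgK hg hε ht0
    have h2 : (t - ε) * (H (g ε) - H (g t)) ≤ |t - ε| * H (g (ε / 2)) := by
      have a1 := antitone_entropy hgK hg (half_pos hε) ht.le
      have a2 := antitone_entropy hgK hg (half_pos hε) (by linarith : ε / 2 ≤ ε)
      have b1 := P.nonneg _ (hgK t ht0)
      have b2 := P.nonneg _ (hgK ε hε)
      refine (le_abs_self _).trans ?_
      rw [abs_mul]
      gcongr
      rw [abs_le]; constructor <;> linarith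
    have h3 : 0 ≤ |t - ε| * H (g (ε / 2)) :=
      mul_nonneg (abs_nonneg _) (P.nonneg _ (hgK _ (half_pos hε)))
    gcongr
    nlinarith
  · have : Tendsto (fun t => 16 / ε * (|t - ε| * H (g (ε / 2)))) (𝓝 ε)
        (𝓝 (16 / ε * (|ε - ε| * H (g (ε / 2))))) := by
      apply Continuous.tendsto; fun_prop
    simpa using this

theorem continuousAt_cost_add (P : PerturbedProblem K e T H M) (hgK : ∀ ε, 0 < ε → g ε ∈ K)
    (hg : ∀ ε, 0 < ε → ∀ y ∈ K, T (g ε) + ε * H (g ε) ≤ T y + ε * H y) {ε : ℝ} (hε : 0 < ε) :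
    ContinuousAt (fun t => T (g t) + t * H (g t)) ε := by
  have hpos : ∀ᶠ t in 𝓝 ε, ε / 2 < t := lt_mem_nhds (by linarith)
  rw [ContinuousAt, tendsto_iff_dist_tendsto_zero]
  refine squeeze_zero' (.of_forall fun _ => dist_nonneg)
    (g := fun t => |t - ε| * H (g (ε / 2))) ?_ ?_
  · filter_upwards [hpos] with t ht
    have ht0 : 0 < t := by linarith
    have h1 := slope_le hgK hg hε ht0
    have h2 := slope_le hgK hg ht0 hε
    have key : ∀ s, ε / 2 ≤ s → ∀ r : ℝ, |r| = |t - ε| → r * H (g s) ≤ |t - ε| * H (g (ε / 2)) := by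
      intro s hs r hr
      rw [← hr]
      have a1 := antitone_entropy hgK hg (half_pos hε) hs
      have b1 := P.nonneg _ (hgK s (by linarith))
      exact mul_le_mul (le_abs_self _) a1 b1 (abs_nonneg _)
    rw [Real.dist_eq, abs_le]
    have := key ε (by linarith) (t - ε) rfl
    have := key t ht.le (ε - t) (abs_sub_comm _ _)
    constructor <;> linarith
  · have : Tendsto (fun t => |t - ε| * H (g (ε / 2))) (𝓝 ε)
        (𝓝 (|ε - ε| * H (g (ε / 2)))) := by
      apply Continuous.tendsto; fun_prop
    simpa using this

theorem continuousAt_entropy (P : PerturbedProblem K e T H M) (hgK : ∀ ε, 0 < ε → g ε ∈ K)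
    (hg : ∀ ε, 0 < ε → ∀ y ∈ K, T (g ε) + ε * H (g ε) ≤ T y + ε * H y) {ε : ℝ} (hε : 0 < ε) :
    ContinuousAt (fun t => H (g t)) ε := by
  have hpos : ∀ᶠ t in 𝓝 ε, 0 < t := lt_mem_nhds hε
  have h1 := P.tendsto_cost (hpos.mono hgK) (hgK ε hε) (P.tendsto_minimizer hgK hg hε)
  have h2 := (P.continuousAt_cost_add hgK hg hε)
  have h3 := (Tendsto.sub h2 h1).div tendsto_id hε.ne'
  have h4 : (T (g ε) + ε * H (g ε) - T (g ε)) / ε = H (g ε) := by field_simp; ring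
  rw [h4] at h3
  refine h3.congr' ?_
  filter_upwards [hpos] with t ht
  simp [ht.ne']

/-- The increment of the value lies between `(t - ε) H (g t)` and `(t - ε) H (g ε)`, and `H ∘ g` is
continuous at `ε`. -/
theorem hasDerivAt_value (P : PerturbedProblem K e T H M) (hgK : ∀ ε, 0 < ε → g ε ∈ K)
    (hg : ∀ ε, 0 < ε → ∀ y ∈ K, T (g ε) + ε * H (g ε) ≤ T y + ε * H y) {ε : ℝ} (hε : 0 < ε) :
    HasDerivAt (fun t => T (g t) + t * H (g t)) (H (g ε)) ε := by
  have hpos : ∀ᶠ t in 𝓝 ε, 0 < t := lt_mem_nhds hε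
  rw [hasDerivAt_iff_isLittleO, isLittleO_iff]
  intro δ hδ
  have hc := Metric.tendsto_nhds.1 (P.continuousAt_entropy hgK hg hε) δ hδ
  filter_upwards [hpos, hc] with t ht htδ
  have h1 := slope_le hgK hg hε ht
  have h2 := slope_le hgK hg ht hε
  rw [Real.dist_eq] at htδ
  rw [smul_eq_mul, Real.norm_eq_abs, Real.norm_eq_abs]
  have h3 : |(t - ε) * (H (g t) - H (g ε))| ≤ δ * |t - ε| := by
    rw [abs_mul, mul_comm]; gcongr
  have h4 := (abs_le.1 h3).1
  have h5 : 0 ≤ δ * |t - ε| := by positivity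
  rw [abs_le]
  constructor <;> linarith

theorem entropy_le_of_cost_le (hgK : ∀ ε, 0 < ε → g ε ∈ K)
    (hg : ∀ ε, 0 < ε → ∀ y ∈ K, T (g ε) + ε * H (g ε) ≤ T y + ε * H y) {x : X} (hx : x ∈ K)
    (hmin : ∀ y ∈ K, T x ≤ T y) {ε : ℝ} (hε : 0 < ε) : H (g ε) ≤ H x := by
  have h1 := hg ε hε x hx
  have h2 := hmin _ (hgK ε hε)
  nlinarith

theorem exists_limit_zero [CompleteSpace E] (P : PerturbedProblem K e T H M)
    (hgK : ∀ ε, 0 < ε → g ε ∈ K)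
    (hg : ∀ ε, 0 < ε → ∀ y ∈ K, T (g ε) + ε * H (g ε) ≤ T y + ε * H y) {x₀ : X} (hx₀ : x₀ ∈ K)
    (hmin : ∀ y ∈ K, T x₀ ≤ T y) :
    ∃ x ∈ K, T x = T x₀ ∧ (∀ y ∈ K, T y = T x₀ → H x ≤ H y ∧ (H y ≤ H x → y = x)) ∧
      Tendsto (fun ε => e (g ε)) (𝓝[>] 0) (𝓝 (e x)) ∧
      Tendsto (fun ε => H (g ε)) (𝓝[>] 0) (𝓝 (H x)) := by
  have hpos : ∀ᶠ t : ℝ in 𝓝[>] 0, 0 < t := self_mem_nhdsWithin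
  -- the entropies increase to their supremum
  set L : ℝ := sSup ((fun ε => H (g ε)) '' Ioi 0) with hL
  have hanti : AntitoneOn (fun ε => H (g ε)) (Ioi 0) := fun s hs t _ hst =>
    antitone_entropy hgK hg hs hst
  have hbdd : BddAbove ((fun ε => H (g ε)) '' Ioi 0) := by
    refine ⟨H x₀, ?_⟩
    rintro _ ⟨ε, hε, rfl⟩
    exact entropy_le_of_cost_le hgK hg hx₀ hmin hε
  have hLle : ∀ ε, 0 < ε → H (g ε) ≤ L := fun ε hε => le_csSup hbdd ⟨ε, hε, rfl⟩
  have hHL : Tendsto (fun ε => H (g ε)) (𝓝[>] 0) (𝓝 L) := hanti.tendsto_nhdsGT hbdd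
  have hTL : Tendsto (fun ε => T (g ε)) (𝓝[>] 0) (𝓝 (T x₀)) := by
    have h0 : Tendsto (fun ε : ℝ => T x₀ + ε * H x₀) (𝓝[>] 0) (𝓝 (T x₀)) := by
      have : Tendsto (fun ε : ℝ => T x₀ + ε * H x₀) (𝓝 0) (𝓝 (T x₀ + 0 * H x₀)) := by
        apply Continuous.tendsto; fun_prop
      simpa using this.mono_left nhdsWithin_le_nhds
    refine tendsto_of_tendsto_of_tendsto_of_le_of_le' tendsto_const_nhds h0 ?_ ?_
    · filter_upwards [hpos] with t ht using hmin _ (hgK t ht)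
    · filter_upwards [hpos] with t ht
      have h1 := hg t ht x₀ hx₀
      have h2 := mul_nonneg ht.le (P.nonneg _ (hgK t ht))
      linarith
  -- The midpoint of `g s` and `g t` costs no more than `g s`, so optimality at `s` forces its
  -- entropy to be at least `H (g s)`. The convexity gap is then at most half of `H (g t) - H (g
  -- s)`, whence the constant 8.
  have hdist : ∀ s t, 0 < t → t ≤ s → dist (e (g s)) (e (g t)) ^ 2 ≤ 8 * (L - H (g s)) := by
    intro s t ht hts
    have hs := ht.trans_le hts
    obtain ⟨m, hm, hTm, hd⟩ := P.mid _ (hgK s hs) _ (hgK t ht)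
    have h1 := hg s hs m hm
    have h2 := hg t ht _ (hgK s hs)
    have h3 := antitone_entropy hgK hg ht hts
    have h4 : T (g t) ≤ T (g s) := by nlinarith
    have h5 : H (g s) ≤ H m := by nlinarith
    have := hLle t ht
    linarith
  set w : ℕ → ℝ := fun n => 1 / ((n : ℝ) + 1) with hw
  have hwpos : ∀ n, 0 < w n := fun n => Nat.one_div_pos_of_nat
  have hwt : Tendsto w atTop (𝓝[>] 0) :=
    tendsto_nhdsWithin_iff.2 ⟨tendsto_one_div_add_atTop_nhds_zero_nat, .of_forall hwpos⟩
  have hb : Tendsto (fun n => 8 * (L - H (g (w n)))) atTop (𝓝 0) := by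
    simpa using ((tendsto_const_nhds (x := L)).sub (hHL.comp hwt)).const_mul 8
  -- The weight 1 is arbitrary: `T` and `H` both converge along the sequence, and the bound on `T x
  -- + H x` yields `H x ≤ L` once `T x` is known.
  obtain ⟨x, hx, hex, hle⟩ := P.exists_limit (u := fun n => g (w n)) (fun n => hgK _ (hwpos n))
    (fun m n hmn => hdist _ _ (hwpos n) (Nat.one_div_le_one_div hmn)) hb one_pos
    ((hTL.comp hwt).add ((hHL.comp hwt).const_mul 1))
  have hTx : T x = T x₀ := tendsto_nhds_unique
    (P.tendsto_cost (.of_forall fun n => hgK _ (hwpos n)) hx hex) (hTL.comp hwt)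
  have hLmin : ∀ y ∈ K, T y = T x₀ → L ≤ H y := by
    intro y hy hTy
    refine csSup_le ⟨_, 1, mem_Ioi.2 one_pos, rfl⟩ ?_
    rintro _ ⟨ε, hε, rfl⟩
    exact entropy_le_of_cost_le hgK hg hy (fun z hz => hTy ▸ hmin z hz) hε
  have hHx : H x = L := le_antisymm (by linarith) (hLmin x hx hTx)
  refine ⟨x, hx, hTx, fun y hy hTy => ⟨hHx ▸ hLmin y hy hTy, fun hyx => ?_⟩, ?_, hHx ▸ hHL⟩
  · refine P.inj hy hx (dist_le_zero.1 ?_)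
    obtain ⟨m, hm, hTm, hd⟩ := P.mid _ hy _ hx
    have := hLmin m hm (by linarith)
    nlinarith [dist_nonneg (x := e y) (y := e x)]
  · refine tendsto_of_sq_dist_le (b := fun ε => 8 * (L - H (g ε))) ?_
      (by simpa using ((tendsto_const_nhds (x := L)).sub hHL).const_mul 8)
    filter_upwards [hpos] with t ht
    -- The argument of `hdist` again, with the limit `x` in place of the minimizer at the smaller
    -- parameter.
    obtain ⟨m, hm, hTm, hd⟩ := P.mid _ (hgK t ht) _ hx
    have h1 := hg t ht m hm
    have h2 := hmin _ (hgK t ht)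
    have h3 : H (g t) ≤ H m := by nlinarith
    linarith

end Selection

end PerturbedProblem

/-! ### Uniform convexity of the entropy in `L¹`. -/

open InformationTheory in
-- The affine terms of `klFun` cancel in the gap, leaving the mean of `a log (a / m)` and `b log (b
-- / m)`, where `m = (a + b) / 2`. A Hellinger-type bound for each term reduces the claim to algebra
-- in the square roots of `a`, `b` and `m`.
theorem klFun_midpoint_gap {a b : ℝ} (ha : 0 ≤ a) (hb : 0 ≤ b) :
    (a - b) ^ 2 ≤ 8 * (a + b) * ((klFun a + klFun b) / 2 - klFun ((a + b) / 2)) := by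
  rcases (add_nonneg ha hb).eq_or_lt with h0 | hs
  · have : a = 0 := by linarith
    have : b = 0 := by linarith
    subst_vars
    simp
  have hm : 0 < (a + b) / 2 := by positivity
  -- `x log (x / m) ≥ 2 (x - √(x m))`
  have key : ∀ x : ℝ, 0 ≤ x →
      2 * (x - √x * √((a + b) / 2)) ≤ x * Real.log x - x * Real.log ((a + b) / 2) := by
    intro x hx
    rcases hx.eq_or_lt with rfl | hx
    · simp
    -- This is `log y ≤ y - 1` at `y = √(m / x)`, to be multiplied by `2 x`.
    have h1 := Real.log_le_sub_one_of_pos (x := √((a + b) / 2) / √x) (by positivity)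
    rw [Real.log_div (by positivity) (by positivity), Real.log_sqrt hx.le,
      Real.log_sqrt hm.le] at h1
    have h2 : x * (√((a + b) / 2) / √x) = √x * √((a + b) / 2) := by
      have : √x ≠ 0 := by positivity
      field_simp
      rw [Real.sq_sqrt hx.le]
    nlinarith [mul_le_mul_of_nonneg_left h1 hx.le]
  have h1 := key a ha
  have h2 := key b hb
  simp only [klFun]
  have hp := Real.sqrt_nonneg a
  have hq := Real.sqrt_nonneg b
  have hr := Real.sqrt_pos.2 hm
  have hpa := Real.sq_sqrt ha
  have hqb := Real.sq_sqrt hb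
  have hrm := Real.sq_sqrt hm.le
  set p := √a
  set q := √b
  set r := √((a + b) / 2)
  have hsum : 2 * r ^ 2 - r * (p + q) ≤ (a * Real.log a + 1 - a + (b * Real.log b + 1 - b)) / 2 -
      ((a + b) / 2 * Real.log ((a + b) / 2) + 1 - (a + b) / 2) := by
    nlinarith
  refine le_trans ?_ (mul_le_mul_of_nonneg_left hsum (by positivity))
  have h3 : (p + q) ^ 2 + (p - q) ^ 2 = 4 * r ^ 2 := by rw [hrm, ← hpa, ← hqb]; ring
  have h4 : p + q ≤ 2 * r := abs_le_of_sq_le_sq' (by nlinarith [sq_nonneg (p - q)]) (by positivity) |>.2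
  have h5 : (p - q) ^ 2 ≤ 4 * r * (2 * r - (p + q)) := by nlinarith
  have h6 : (a - b) ^ 2 = (p + q) ^ 2 * (p - q) ^ 2 := by rw [← hpa, ← hqb]; ring
  have h7 : 8 * (a + b) = 16 * r ^ 2 := by rw [hrm]; ring
  rw [h6, h7]
  calc (p + q) ^ 2 * (p - q) ^ 2 ≤ (4 * r ^ 2) * (4 * r * (2 * r - (p + q))) :=
        mul_le_mul (by nlinarith [sq_nonneg (p - q)]) h5 (sq_nonneg _) (by positivity)
    _ = _ := by ring

namespace EntropicOT

open InformationTheory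

variable {α : Type*} {mα : MeasurableSpace α} {P : Measure α}

/-- The density of a finite measure with respect to `P`, as an element of `L¹(P)`. -/
noncomputable def densityL1 (P γ : Measure α) [IsFiniteMeasure γ] : Lp ℝ 1 P :=
  (Measure.integrable_toReal_rnDeriv (μ := γ) (ν := P)).toL1 _

theorem coeFn_densityL1 (P γ : Measure α) [IsFiniteMeasure γ] :
    densityL1 P γ =ᵐ[P] fun x => (γ.rnDeriv P x).toReal :=
  Integrable.coeFn_toL1 _

theorem dist_densityL1 (γ γ' : Measure α) [IsFiniteMeasure γ] [IsFiniteMeasure γ'] :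
    dist (densityL1 P γ) (densityL1 P γ') =
      ∫ x, |(γ.rnDeriv P x).toReal - (γ'.rnDeriv P x).toReal| ∂P := by
  rw [dist_eq_norm, L1.norm_eq_integral_norm]
  refine integral_congr_ae ?_
  filter_upwards [Lp.coeFn_sub (densityL1 P γ) (densityL1 P γ'), coeFn_densityL1 P γ,
    coeFn_densityL1 P γ'] with x h1 h2 h3
  rw [h1, Pi.sub_apply, h2, h3, Real.norm_eq_abs]

variable [IsProbabilityMeasure P]

theorem measure_eq_of_densityL1_eq {γ γ' : Measure α} [IsFiniteMeasure γ] [IsFiniteMeasure γ']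
    (h : γ ≪ P) (h' : γ' ≪ P) (heq : densityL1 P γ = densityL1 P γ') : γ = γ' := by
  rw [← Measure.withDensity_rnDeriv_eq γ P h, ← Measure.withDensity_rnDeriv_eq γ' P h']
  refine withDensity_congr_ae ?_
  filter_upwards [coeFn_densityL1 P γ, coeFn_densityL1 P γ', γ.rnDeriv_ne_top P,
    γ'.rnDeriv_ne_top P] with x h1 h2 h3 h4
  rw [heq, h2] at h1
  exact ((ENNReal.toReal_eq_toReal_iff' h4 h3).1 h1).symm

theorem abs_integral_sub_le {γ γ' : Measure α} [IsFiniteMeasure γ] [IsFiniteMeasure γ']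
    (h : γ ≪ P) (h' : γ' ≪ P) {f : α → ℝ} (hf : AEStronglyMeasurable f P) {M : ℝ}
    (hM : ∀ x, |f x| ≤ M) :
    |∫ x, f x ∂γ - ∫ x, f x ∂γ'| ≤ M * dist (densityL1 P γ) (densityL1 P γ') := by
  have hi : ∀ (σ : Measure α) [IsFiniteMeasure σ],
      Integrable (fun x => (σ.rnDeriv P x).toReal * f x) P := fun σ _ =>
    Measure.integrable_toReal_rnDeriv.mul_bdd (c := M) hf (.of_forall hM)
  rw [← integral_toReal_rnDeriv_mul h, ← integral_toReal_rnDeriv_mul h',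
    ← integral_sub (hi γ) (hi γ'), dist_densityL1, ← integral_const_mul]
  refine norm_integral_le_of_norm_le (f := fun x => (γ.rnDeriv P x).toReal * f x -
    (γ'.rnDeriv P x).toReal * f x) ?_ (.of_forall fun x => ?_)
  · exact ((Measure.integrable_toReal_rnDeriv.sub Measure.integrable_toReal_rnDeriv).abs).const_mul M
  · rw [← sub_mul, Real.norm_eq_abs, abs_mul, mul_comm]
    gcongr
    exact hM x

/-- Cauchy-Schwarz applied to the pointwise gap: the weight `ρ + ρ'` has total mass 2, which turns
the factor 8 into 16. -/
theorem sq_dist_densityL1_le {γ γ' σ : Measure α} [IsProbabilityMeasure γ]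
    [IsProbabilityMeasure γ'] [IsFiniteMeasure σ] (h : klDiv γ P ≠ ∞) (h' : klDiv γ' P ≠ ∞)
    (hσP : σ ≪ P) (hσ : (fun x => (σ.rnDeriv P x).toReal) =ᵐ[P]
      fun x => ((γ.rnDeriv P x).toReal + (γ'.rnDeriv P x).toReal) / 2) :
    klDiv σ P ≠ ∞ ∧ dist (densityL1 P γ) (densityL1 P γ') ^ 2 ≤
      16 * (((klDiv γ P).toReal + (klDiv γ' P).toReal) / 2 - (klDiv σ P).toReal) := by
  obtain ⟨hac, hint⟩ := klDiv_ne_top_iff.1 h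
  obtain ⟨hac', hint'⟩ := klDiv_ne_top_iff.1 h'
  rw [← integrable_klFun_rnDeriv_iff hac] at hint
  rw [← integrable_klFun_rnDeriv_iff hac'] at hint'
  set ρ : α → ℝ := fun x => (γ.rnDeriv P x).toReal with hρ
  set ρ' : α → ℝ := fun x => (γ'.rnDeriv P x).toReal with hρ'
  have hρ0 : ∀ x, 0 ≤ ρ x := fun x => ENNReal.toReal_nonneg
  have hρ'0 : ∀ x, 0 ≤ ρ' x := fun x => ENNReal.toReal_nonneg
  have hgap : ∀ x, (ρ x - ρ' x) ^ 2 ≤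
      8 * (ρ x + ρ' x) * ((klFun (ρ x) + klFun (ρ' x)) / 2 - klFun ((ρ x + ρ' x) / 2)) :=
    fun x => klFun_midpoint_gap (hρ0 x) (hρ'0 x)
  have hgap0 : ∀ x, 0 ≤ (klFun (ρ x) + klFun (ρ' x)) / 2 - klFun ((ρ x + ρ' x) / 2) := by
    intro x
    have := convexOn_klFun.2 (hρ0 x) (hρ'0 x) (by norm_num : (0 : ℝ) ≤ 1 / 2)
      (by norm_num : (0 : ℝ) ≤ 1 / 2) (by norm_num)
    simp only [smul_eq_mul] at this
    rw [show 1 / 2 * ρ x + 1 / 2 * ρ' x = (ρ x + ρ' x) / 2 by ring] at this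
    linarith
  have hρm : Measurable ρ := (Measure.measurable_rnDeriv _ _).ennreal_toReal
  have hρm' : Measurable ρ' := (Measure.measurable_rnDeriv _ _).ennreal_toReal
  have hmid : Integrable (fun x => klFun ((ρ x + ρ' x) / 2)) P := by
    refine ((hint.add hint').div_const 2).mono' ?_ (.of_forall fun x => ?_)
    · exact (measurable_klFun.comp ((hρm.add hρm').div_const 2)).aestronglyMeasurable
    · rw [Real.norm_of_nonneg (klFun_nonneg (by linarith [hρ0 x, hρ'0 x]))]
      have := hgap0 x
      simp only [Pi.add_apply]
      linarith
  have havg : Integrable (fun x => (klFun (ρ x) + klFun (ρ' x)) / 2) P :=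
    (hint.add hint').div_const 2
  have hσk : (fun x => klFun (σ.rnDeriv P x).toReal) =ᵐ[P] fun x => klFun ((ρ x + ρ' x) / 2) := by
    filter_upwards [hσ] with x hx
    rw [hx]
  have hσi : klDiv σ P ≠ ∞ := klDiv_ne_top hσP
    ((integrable_klFun_rnDeriv_iff hσP).1 (hmid.congr hσk.symm))
  refine ⟨hσi, ?_⟩
  rw [toReal_klDiv_eq_integral_klFun hac, toReal_klDiv_eq_integral_klFun hac',
    toReal_klDiv_eq_integral_klFun hσP, integral_congr_ae hσk,
    ← integral_add hint hint', ← integral_div, ← integral_sub havg hmid, dist_densityL1]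
  set G : ℝ := ∫ x, ((klFun (ρ x) + klFun (ρ' x)) / 2 - klFun ((ρ x + ρ' x) / 2)) ∂P with hG
  set D : ℝ := ∫ x, |ρ x - ρ' x| ∂P with hD
  have hG0 : 0 ≤ G := integral_nonneg hgap0
  have hD0 : 0 ≤ D := integral_nonneg fun x => abs_nonneg _
  have hρi : Integrable ρ P := Measure.integrable_toReal_rnDeriv
  have hρi' : Integrable ρ' P := Measure.integrable_toReal_rnDeriv
  have hρ1 : ∫ x, ρ x ∂P = 1 := by
    rw [hρ, Measure.integral_toReal_rnDeriv hac]; simp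
  have hρ1' : ∫ x, ρ' x ∂P = 1 := by
    rw [hρ', Measure.integral_toReal_rnDeriv hac']; simp
  -- Cauchy-Schwarz in parametric form: `8 (ρ + ρ') g ≤ (4 / t * g + t / 2 * (ρ + ρ'))²` by the
  -- arithmetic-geometric mean inequality. The choice `t = D / 2` below gives `D² ≤ 16 G`.
  have main : ∀ t : ℝ, 0 < t → D ≤ 4 / t * G + t := by
    intro t ht
    have hGi : Integrable (fun x => (klFun (ρ x) + klFun (ρ' x)) / 2 - klFun ((ρ x + ρ' x) / 2)) P :=
      havg.sub hmid
    have hsum : Integrable (fun x => ρ x + ρ' x) P := hρi.add hρi'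
    have : D ≤ ∫ x, (4 / t * ((klFun (ρ x) + klFun (ρ' x)) / 2 - klFun ((ρ x + ρ' x) / 2)) +
        t / 2 * (ρ x + ρ' x)) ∂P := by
      refine integral_mono (hρi.sub hρi').abs
        ((hGi.const_mul (4 / t)).add (hsum.const_mul (t / 2))) fun x => ?_
      have h1 := hgap x
      have h2 := hgap0 x
      set g := (klFun (ρ x) + klFun (ρ' x)) / 2 - klFun ((ρ x + ρ' x) / 2)
      have h3 : 0 ≤ ρ x + ρ' x := add_nonneg (hρ0 x) (hρ'0 x)
      refine abs_le_of_sq_le_sq (h1.trans ?_) (by positivity)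
      have h4 : (4 / t * g + t / 2 * (ρ x + ρ' x)) ^ 2 =
          8 * (ρ x + ρ' x) * g + (4 / t * g - t / 2 * (ρ x + ρ' x)) ^ 2 := by
        field_simp; ring
      show _ ≤ (4 / t * g + t / 2 * (ρ x + ρ' x)) ^ 2
      rw [h4]
      exact le_add_of_nonneg_right (sq_nonneg _)
    refine this.trans_eq ?_
    rw [integral_add (hGi.const_mul _) (hsum.const_mul (t / 2)),
      integral_const_mul, integral_const_mul, integral_add hρi hρi', hρ1, hρ1', hG]
    ring
  change D ^ 2 ≤ 16 * G
  rcases hD0.eq_or_lt with h0 | hpos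
  · rw [← h0]; nlinarith
  · have := main (D / 2) (half_pos hpos)
    have h5 : 4 / (D / 2) * G * D = 8 * G := by field_simp; ring
    nlinarith

/-- The limit density defines `σ`. `L¹` convergence gives convergence on every measurable set, which
preserves total mass and later the marginals; Fatou along an almost everywhere convergent
subsequence gives the entropy bound, as `klFun` is nonnegative on densities. -/
theorem exists_measure_of_tendsto_densityL1 {γ : ℕ → Measure α}
    [∀ n, IsProbabilityMeasure (γ n)] (hγ : ∀ n, klDiv (γ n) P ≠ ∞) {f : Lp ℝ 1 P}
    (hf : Tendsto (fun n => densityL1 P (γ n)) atTop (𝓝 f)) {B : ℝ}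
    (hB : Tendsto (fun n => (klDiv (γ n) P).toReal) atTop (𝓝 B)) :
    ∃ (σ : Measure α) (_ : IsProbabilityMeasure σ), klDiv σ P ≠ ∞ ∧ (klDiv σ P).toReal ≤ B ∧
      densityL1 P σ = f ∧ ∀ A, MeasurableSet A → Tendsto (fun n => γ n A) atTop (𝓝 (σ A)) := by
  obtain ⟨ns, hns, hae⟩ := (tendstoInMeasure_of_tendsto_Lp hf).exists_seq_tendsto_ae
  have hall : ∀ᵐ x ∂P, ∀ n, densityL1 P (γ n) x = ((γ n).rnDeriv P x).toReal :=
    ae_all_iff.2 fun n => coeFn_densityL1 P (γ n)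
  have hae' : ∀ᵐ x ∂P, Tendsto (fun i => ((γ (ns i)).rnDeriv P x).toReal) atTop (𝓝 (f x)) := by
    filter_upwards [hae, hall] with x h1 h2
    simpa only [h2] using h1
  have hf0 : ∀ᵐ x ∂P, 0 ≤ f x := by
    filter_upwards [hae'] with x h1
    exact ge_of_tendsto' h1 fun _ => ENNReal.toReal_nonneg
  have hfi : Integrable f P := L1.integrable_coeFn f
  have hac : ∀ n, γ n ≪ P := fun n => (klDiv_ne_top_iff.1 (hγ n)).1
  set σ : Measure α := P.withDensity fun x => ENNReal.ofReal (f x) with hσ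
  have hσac : σ ≪ P := withDensity_absolutelyContinuous _ _
  have : IsFiniteMeasure σ := isFiniteMeasure_withDensity_ofReal hfi.2
  have hrn : (fun x => (σ.rnDeriv P x).toReal) =ᵐ[P] f := by
    filter_upwards [Measure.rnDeriv_withDensity₀ P hfi.aemeasurable.ennreal_ofReal, hf0]
      with x h1 h2
    rw [h1, ENNReal.toReal_ofReal h2]
  have hden : densityL1 P σ = f := Lp.ext ((coeFn_densityL1 P σ).trans hrn)
  have hset : ∀ A, MeasurableSet A → Tendsto (fun n => γ n A) atTop (𝓝 (σ A)) := by
    intro A hA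
    rw [← ENNReal.tendsto_toReal_iff (fun n => measure_ne_top _ _) (measure_ne_top _ _),
      tendsto_iff_dist_tendsto_zero]
    refine squeeze_zero (fun _ => dist_nonneg) (fun n => ?_)
      (tendsto_iff_dist_tendsto_zero.1 hf)
    have := abs_integral_sub_le (hac n) hσac (f := A.indicator 1) (M := 1)
      (measurable_one.indicator hA).aestronglyMeasurable (fun x => by
        by_cases hx : x ∈ A <;> simp [hx])
    rw [integral_indicator_one hA, integral_indicator_one hA, hden, one_mul] at this
    exact this
  have hprob : IsProbabilityMeasure σ :=
    ⟨tendsto_nhds_unique (hset univ .univ) (by simp)⟩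
  have hle : klDiv σ P ≤ ENNReal.ofReal B := by
    have hlim : Tendsto (fun i => klDiv (γ (ns i)) P) atTop (𝓝 (ENNReal.ofReal B)) := by
      refine (ENNReal.tendsto_ofReal (hB.comp hns.tendsto_atTop)).congr fun i => ?_
      exact ENNReal.ofReal_toReal (hγ _)
    rw [← hlim.liminf_eq, klDiv_eq_lintegral_klFun_of_ac hσac]
    simp only [klDiv_eq_lintegral_klFun_of_ac (hac _)]
    refine le_trans (lintegral_mono_ae ?_) (lintegral_liminf_le fun i => ?_)
    · filter_upwards [hae', hrn] with x h1 h2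
      rw [h2]
      exact (ENNReal.tendsto_ofReal ((continuous_klFun.tendsto _).comp h1)).liminf_eq.ge
    · exact (measurable_klFun.comp
        (Measure.measurable_rnDeriv _ _).ennreal_toReal).ennreal_ofReal
  have hB0 : 0 ≤ B := ge_of_tendsto' hB fun _ => ENNReal.toReal_nonneg
  exact ⟨σ, hprob, ne_top_of_le_ne_top ENNReal.ofReal_ne_top hle,
    ENNReal.toReal_le_of_le_ofReal hB0 hle, hden, hset⟩

end EntropicOT

/-! ### Couplings of finite entropy as a perturbed problem. -/

namespace EntropicOT

open InformationTheory

variable {d : ℕ} {μ ν : Measure (EuclideanSpace ℝ (Fin d))}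
  {c : EuclideanSpace ℝ (Fin d) × EuclideanSpace ℝ (Fin d) → ℝ}

/-- The couplings of finite relative entropy. -/
def finiteCouplings (μ ν : Measure (EuclideanSpace ℝ (Fin d))) :
    Set (ProbabilityMeasure (EuclideanSpace ℝ (Fin d) × EuclideanSpace ℝ (Fin d))) :=
  {γ | γ ∈ couplings μ ν ∧ ent μ ν γ ≠ ∞}

theorem absolutelyContinuous_of_mem_finiteCouplings
    {γ : ProbabilityMeasure (EuclideanSpace ℝ (Fin d) × EuclideanSpace ℝ (Fin d))}
    (hγ : γ ∈ finiteCouplings μ ν) :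
    (γ : Measure (EuclideanSpace ℝ (Fin d) × EuclideanSpace ℝ (Fin d))) ≪ μ.prod ν :=
  (klDiv_ne_top_iff.1 hγ.2).1

theorem abs_transportCost_le {M : ℝ} (hM0 : 0 ≤ M)
    (hM : ∀ p ∈ μ.support ×ˢ ν.support, |c p| ≤ M)
    (γ : ProbabilityMeasure (EuclideanSpace ℝ (Fin d) × EuclideanSpace ℝ (Fin d))) :
    |transportCost μ ν c γ| ≤ M := by
  refine (norm_setIntegral_le_of_norm_le_const (f := c) (measure_lt_top _ _) hM).trans ?_
  exact mul_le_of_le_one_right hM0 measureReal_le_one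

theorem measurableSet_support_prod :
    MeasurableSet (μ.support ×ˢ ν.support) :=
  (Measure.isClosed_support.prod Measure.isClosed_support).measurableSet

/-- Extending the cost by zero off the supports gives a globally bounded integrand, as
`abs_integral_sub_le` and `exists_midpoint` require. -/
theorem transportCost_eq_integral_indicator
    (γ : ProbabilityMeasure (EuclideanSpace ℝ (Fin d) × EuclideanSpace ℝ (Fin d))) :
    transportCost μ ν c γ = ∫ p, (μ.support ×ˢ ν.support).indicator c p
      ∂(γ : Measure (EuclideanSpace ℝ (Fin d) × EuclideanSpace ℝ (Fin d))) :=
  (integral_indicator measurableSet_support_prod).symm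

theorem aestronglyMeasurable_indicator_cost (hc : ContinuousOn c (μ.support ×ˢ ν.support))
    (P : Measure (EuclideanSpace ℝ (Fin d) × EuclideanSpace ℝ (Fin d))) :
    AEStronglyMeasurable ((μ.support ×ˢ ν.support).indicator c) P :=
  (aestronglyMeasurable_indicator_iff measurableSet_support_prod).2
    (hc.aestronglyMeasurable measurableSet_support_prod)

theorem abs_indicator_cost_le {M : ℝ} (hM0 : 0 ≤ M)
    (hM : ∀ p ∈ μ.support ×ˢ ν.support, |c p| ≤ M)
    (p : EuclideanSpace ℝ (Fin d) × EuclideanSpace ℝ (Fin d)) :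
    |(μ.support ×ˢ ν.support).indicator c p| ≤ M := by
  by_cases hp : p ∈ μ.support ×ˢ ν.support
  · simpa [hp] using hM p hp
  · simpa [hp] using hM0

theorem exists_midpoint [IsProbabilityMeasure μ] [IsProbabilityMeasure ν]
    {γ γ' : ProbabilityMeasure (EuclideanSpace ℝ (Fin d) × EuclideanSpace ℝ (Fin d))}
    (hγ : γ ∈ finiteCouplings μ ν) (hγ' : γ' ∈ finiteCouplings μ ν) :
    ∃ σ ∈ finiteCouplings μ ν,
      (∀ (f : EuclideanSpace ℝ (Fin d) × EuclideanSpace ℝ (Fin d) → ℝ) (M : ℝ),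
        (∀ P : Measure (EuclideanSpace ℝ (Fin d) × EuclideanSpace ℝ (Fin d)),
          AEStronglyMeasurable f P) → (∀ p, |f p| ≤ M) →
        ∫ p, f p ∂(σ : Measure (EuclideanSpace ℝ (Fin d) × EuclideanSpace ℝ (Fin d))) =
          (∫ p, f p ∂(γ : Measure (EuclideanSpace ℝ (Fin d) × EuclideanSpace ℝ (Fin d))) +
          ∫ p, f p ∂(γ' : Measure (EuclideanSpace ℝ (Fin d) × EuclideanSpace ℝ (Fin d)))) / 2) ∧
      dist (densityL1 (μ.prod ν) γ) (densityL1 (μ.prod ν) γ') ^ 2 ≤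
        16 * (((ent μ ν γ).toReal + (ent μ ν γ').toReal) / 2 - (ent μ ν σ).toReal) := by
  set g : Measure (EuclideanSpace ℝ (Fin d) × EuclideanSpace ℝ (Fin d)) := γ.toMeasure
  set g' : Measure (EuclideanSpace ℝ (Fin d) × EuclideanSpace ℝ (Fin d)) := γ'.toMeasure
  have hac : g ≪ μ.prod ν := absolutelyContinuous_of_mem_finiteCouplings hγ
  have hac' : g' ≪ μ.prod ν := absolutelyContinuous_of_mem_finiteCouplings hγ'
  set s : Measure (EuclideanSpace ℝ (Fin d) × EuclideanSpace ℝ (Fin d)) :=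
    (2⁻¹ : ℝ≥0∞) • g + (2⁻¹ : ℝ≥0∞) • g' with hs
  have h2 : (2⁻¹ : ℝ≥0∞) ≠ ∞ := by simp
  have hsp : IsProbabilityMeasure s := ⟨by simp [hs, ENNReal.inv_two_add_inv_two]⟩
  have hsac : s ≪ μ.prod ν :=
    Measure.AbsolutelyContinuous.add_left (hac.smul_left _) (hac'.smul_left _)
  have hfin : ∀ h : Measure (EuclideanSpace ℝ (Fin d) × EuclideanSpace ℝ (Fin d)),
      IsFiniteMeasure h → IsFiniteMeasure ((2⁻¹ : ℝ≥0∞) • h) := fun h _ => Measure.smul_finite h h2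
  have := hfin g inferInstance
  have := hfin g' inferInstance
  have hrn : (fun x => (s.rnDeriv (μ.prod ν) x).toReal) =ᵐ[μ.prod ν] fun x =>
      ((g.rnDeriv (μ.prod ν) x).toReal + (g'.rnDeriv (μ.prod ν) x).toReal) / 2 := by
    filter_upwards [Measure.rnDeriv_add' ((2⁻¹ : ℝ≥0∞) • g) ((2⁻¹ : ℝ≥0∞) • g') (μ.prod ν),
      Measure.rnDeriv_smul_left_of_ne_top g (μ.prod ν) h2,
      Measure.rnDeriv_smul_left_of_ne_top g' (μ.prod ν) h2, g.rnDeriv_ne_top (μ.prod ν),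
      g'.rnDeriv_ne_top (μ.prod ν)] with x h3 h4 h5 h6 h7
    rw [h3, Pi.add_apply, h4, h5, Pi.smul_apply, Pi.smul_apply, smul_eq_mul, smul_eq_mul,
      ENNReal.toReal_add (ENNReal.mul_ne_top h2 h6) (ENNReal.mul_ne_top h2 h7)]
    simp only [ENNReal.toReal_mul, ENNReal.toReal_inv, ENNReal.toReal_ofNat]
    ring
  obtain ⟨hent, hd⟩ := sq_dist_densityL1_le hγ.2 hγ'.2 hsac hrn
  have hsmul : ∀ ρ : Measure (EuclideanSpace ℝ (Fin d)),
      (2⁻¹ : ℝ≥0∞) • ρ + (2⁻¹ : ℝ≥0∞) • ρ = ρ := fun ρ => by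
    rw [← add_smul, ENNReal.inv_two_add_inv_two, one_smul]
  refine ⟨⟨s, hsp⟩, ⟨⟨?_, ?_⟩, hent⟩, fun f M hf hM => ?_, hd⟩
  · rw [ProbabilityMeasure.coe_mk, hs, Measure.fst_add, Measure.fst, Measure.fst,
      Measure.map_smul, Measure.map_smul]
    change (2⁻¹ : ℝ≥0∞) • g.fst + (2⁻¹ : ℝ≥0∞) • g'.fst = μ
    rw [hγ.1.1, hγ'.1.1, hsmul]
  · rw [ProbabilityMeasure.coe_mk, hs, Measure.snd_add, Measure.snd, Measure.snd,
      Measure.map_smul, Measure.map_smul]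
    change (2⁻¹ : ℝ≥0∞) • g.snd + (2⁻¹ : ℝ≥0∞) • g'.snd = ν
    rw [hγ.1.2, hγ'.1.2, hsmul]
  · have hi : ∀ h : Measure (EuclideanSpace ℝ (Fin d) × EuclideanSpace ℝ (Fin d)),
        IsFiniteMeasure h → Integrable f h := fun h _ => .of_bound (hf h) M (.of_forall hM)
    rw [ProbabilityMeasure.coe_mk, hs, integral_add_measure (hi _ inferInstance)
      (hi _ inferInstance), integral_smul_measure, integral_smul_measure]
    simp only [ENNReal.toReal_inv, ENNReal.toReal_ofNat, smul_eq_mul]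
    ring

theorem prod_mem_finiteCouplings (μ ν : Measure (EuclideanSpace ℝ (Fin d)))
    [IsProbabilityMeasure μ] [IsProbabilityMeasure ν] :
    ∃ γ ∈ finiteCouplings μ ν, ent μ ν γ = 0 := by
  have h : ent μ ν ⟨μ.prod ν, inferInstance⟩ = 0 := klDiv_self (μ.prod ν)
  exact ⟨⟨μ.prod ν, inferInstance⟩, ⟨⟨Measure.fst_prod, Measure.snd_prod⟩, by simp [h]⟩, h⟩

theorem perturbedProblem [IsProbabilityMeasure μ] [IsProbabilityMeasure ν]
    (hc : ContinuousOn c (μ.support ×ˢ ν.support)) {M : ℝ} (hM0 : 0 ≤ M)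
    (hM : ∀ p ∈ μ.support ×ˢ ν.support, |c p| ≤ M) :
    PerturbedProblem (finiteCouplings μ ν) (fun γ => densityL1 (μ.prod ν) γ)
      (transportCost μ ν c) (fun γ => (ent μ ν γ).toReal) M where
  nonneg _ _ := ENNReal.toReal_nonneg
  bdd γ _ := abs_transportCost_le hM0 hM γ
  lip γ hγ γ' hγ' := by
    rw [transportCost_eq_integral_indicator, transportCost_eq_integral_indicator]
    exact abs_integral_sub_le (absolutelyContinuous_of_mem_finiteCouplings hγ)
      (absolutelyContinuous_of_mem_finiteCouplings hγ') (aestronglyMeasurable_indicator_cost hc _)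
      (abs_indicator_cost_le hM0 hM)
  inj γ hγ γ' hγ' h := Subtype.ext <| measure_eq_of_densityL1_eq
    (γ := γ.toMeasure) (γ' := γ'.toMeasure)
    (absolutelyContinuous_of_mem_finiteCouplings hγ)
    (absolutelyContinuous_of_mem_finiteCouplings hγ') h
  mid γ hγ γ' hγ' := by
    obtain ⟨σ, hσ, hint, hd⟩ := exists_midpoint hγ hγ'
    refine ⟨σ, hσ, ?_, hd⟩
    simp only [transportCost_eq_integral_indicator]
    exact hint _ M (aestronglyMeasurable_indicator_cost hc) (abs_indicator_cost_le hM0 hM)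
  closed u hu f hf B hB := by
    obtain ⟨σ, hσ, hent, hle, hden, hset⟩ := exists_measure_of_tendsto_densityL1
      (γ := fun n => (u n : Measure (EuclideanSpace ℝ (Fin d) × EuclideanSpace ℝ (Fin d))))
      (fun n => (hu n).2) hf hB
    refine ⟨⟨σ, hσ⟩, ⟨⟨?_, ?_⟩, hent⟩, hden, hle⟩
    · ext A hA
      rw [ProbabilityMeasure.coe_mk, Measure.fst_apply hA]
      refine tendsto_nhds_unique (hset _ (measurable_fst hA)) ?_
      refine tendsto_const_nhds.congr fun n => ?_
      rw [← Measure.fst_apply hA, (hu n).1.1]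
    · ext A hA
      rw [ProbabilityMeasure.coe_mk, Measure.snd_apply hA]
      refine tendsto_nhds_unique (hset _ (measurable_snd hA)) ?_
      refine tendsto_const_nhds.congr fun n => ?_
      rw [← Measure.snd_apply hA, (hu n).1.2]
  exists_zero := by
    obtain ⟨γ, hγ, h⟩ := prod_mem_finiteCouplings μ ν
    exact ⟨γ, hγ, by simp [h]⟩

theorem tendsto_of_tendsto_densityL1 [IsProbabilityMeasure μ] [IsProbabilityMeasure ν]
    {ι : Type*} {l : Filter ι}
    {u : ι → ProbabilityMeasure (EuclideanSpace ℝ (Fin d) × EuclideanSpace ℝ (Fin d))}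
    {γ : ProbabilityMeasure (EuclideanSpace ℝ (Fin d) × EuclideanSpace ℝ (Fin d))}
    (hu : ∀ᶠ i in l, u i ∈ finiteCouplings μ ν) (hγ : γ ∈ finiteCouplings μ ν)
    (h : Tendsto (fun i => densityL1 (μ.prod ν)
      (u i : Measure (EuclideanSpace ℝ (Fin d) × EuclideanSpace ℝ (Fin d)))) l
      (𝓝 (densityL1 (μ.prod ν) γ))) : Tendsto u l (𝓝 γ) := by
  rw [ProbabilityMeasure.tendsto_iff_forall_integral_tendsto]
  intro f
  rw [tendsto_iff_dist_tendsto_zero] at h ⊢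
  refine squeeze_zero' (.of_forall fun _ => dist_nonneg) ?_ (by simpa using h.const_mul ‖f‖)
  filter_upwards [hu] with i hi
  exact abs_integral_sub_le (absolutelyContinuous_of_mem_finiteCouplings hi)
    (absolutelyContinuous_of_mem_finiteCouplings hγ) f.continuous.aestronglyMeasurable
    f.norm_coe_le_norm

/-! ### From the extended-real functional to real values. -/

theorem entropicFunctional_eq_coe (c : EuclideanSpace ℝ (Fin d) × EuclideanSpace ℝ (Fin d) → ℝ)
    (ε : ℝ) {γ : ProbabilityMeasure (EuclideanSpace ℝ (Fin d) × EuclideanSpace ℝ (Fin d))}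
    (hγ : ent μ ν γ ≠ ∞) : entropicFunctional μ ν c ε γ =
      ((transportCost μ ν c γ + ε * (ent μ ν γ).toReal : ℝ) : EReal) := by
  rw [entropicFunctional, ← EReal.coe_ennreal_toReal hγ]
  norm_cast

theorem entropicFunctional_eq_top (c : EuclideanSpace ℝ (Fin d) × EuclideanSpace ℝ (Fin d) → ℝ)
    {ε : ℝ} (hε : 0 < ε)
    {γ : ProbabilityMeasure (EuclideanSpace ℝ (Fin d) × EuclideanSpace ℝ (Fin d))}
    (hγ : ent μ ν γ = ∞) : entropicFunctional μ ν c ε γ = ⊤ := by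
  rw [entropicFunctional, hγ, EReal.coe_ennreal_top, EReal.coe_mul_top_of_pos hε,
    EReal.coe_add_top]

theorem le_entropicFunctional {ε : ℝ} (hε : 0 < ε)
    {g : ProbabilityMeasure (EuclideanSpace ℝ (Fin d) × EuclideanSpace ℝ (Fin d))}
    (hmin : ∀ γ ∈ finiteCouplings μ ν, transportCost μ ν c g + ε * (ent μ ν g).toReal ≤
      transportCost μ ν c γ + ε * (ent μ ν γ).toReal)
    {γ : ProbabilityMeasure (EuclideanSpace ℝ (Fin d) × EuclideanSpace ℝ (Fin d))}
    (hγ : γ ∈ couplings μ ν) :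
    ((transportCost μ ν c g + ε * (ent μ ν g).toReal : ℝ) : EReal) ≤
      entropicFunctional μ ν c ε γ := by
  by_cases h : ent μ ν γ = ∞
  · rw [entropicFunctional_eq_top c hε h]; exact le_top
  · rw [entropicFunctional_eq_coe c ε h]
    exact EReal.coe_le_coe (hmin γ ⟨hγ, h⟩)

theorem entropicInf_eq_coe {ε : ℝ} (hε : 0 < ε)
    {g : ProbabilityMeasure (EuclideanSpace ℝ (Fin d) × EuclideanSpace ℝ (Fin d))}
    (hg : g ∈ finiteCouplings μ ν)
    (hmin : ∀ γ ∈ finiteCouplings μ ν, transportCost μ ν c g + ε * (ent μ ν g).toReal ≤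
      transportCost μ ν c γ + ε * (ent μ ν γ).toReal) :
    entropicInf μ ν c ε = ((transportCost μ ν c g + ε * (ent μ ν g).toReal : ℝ) : EReal) :=
  le_antisymm ((iInf₂_le g hg.1).trans_eq (entropicFunctional_eq_coe c ε hg.2))
    (le_iInf₂ fun _ hγ => le_entropicFunctional hε hmin hγ)

theorem entropicInf_zero_eq_coe
    {g : ProbabilityMeasure (EuclideanSpace ℝ (Fin d) × EuclideanSpace ℝ (Fin d))}
    (hg : g ∈ optimalPlans μ ν c) :
    entropicInf μ ν c 0 = (transportCost μ ν c g : EReal) := by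
  refine le_antisymm ((iInf₂_le g hg.1).trans_eq (entropicFunctional_zero μ ν c g))
    (le_iInf₂ fun γ hγ => ?_)
  rw [entropicFunctional_zero]
  exact EReal.coe_le_coe (hg.2 hγ)

theorem entropicPlans_eq_singleton [IsProbabilityMeasure μ] [IsProbabilityMeasure ν] {M : ℝ}
    (P : PerturbedProblem (finiteCouplings μ ν) (fun γ => densityL1 (μ.prod ν) γ)
      (transportCost μ ν c) (fun γ => (ent μ ν γ).toReal) M) {ε : ℝ} (hε : 0 < ε)
    {g : ProbabilityMeasure (EuclideanSpace ℝ (Fin d) × EuclideanSpace ℝ (Fin d))}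
    (hg : g ∈ finiteCouplings μ ν)
    (hmin : ∀ γ ∈ finiteCouplings μ ν, transportCost μ ν c g + ε * (ent μ ν g).toReal ≤
      transportCost μ ν c γ + ε * (ent μ ν γ).toReal) :
    entropicPlans μ ν c ε = {g} := by
  ext γ
  rw [mem_singleton_iff]
  constructor
  · rintro ⟨hγ, hγmin⟩
    have hle := isMinOn_iff.1 hγmin g hg.1
    rw [entropicFunctional_eq_coe c ε hg.2] at hle
    have hfin : ent μ ν γ ≠ ∞ := by
      intro h
      rw [entropicFunctional_eq_top c hε h] at hle
      exact absurd (top_le_iff.1 hle) (EReal.coe_ne_top _)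
    rw [entropicFunctional_eq_coe c ε hfin] at hle
    exact P.eq_of_isMinOn hε hg ⟨hγ, hfin⟩ hmin (EReal.coe_le_coe_iff.1 hle)
  · rintro rfl
    refine ⟨hg.1, isMinOn_iff.2 fun σ hσ => ?_⟩
    rw [entropicFunctional_eq_coe c ε hg.2]
    exact le_entropicFunctional hε hmin hσ

end EntropicOT

/-! ### Regularity up to zero and the main theorem. -/

/-- A function with derivative `h` on `(0, ∞)`, whose slopes at `0` are squeezed between `h` and
its limit `L` at `0`, is `C¹` on `[0, ∞)`. -/
theorem contDiffOn_Ici_of_slope_bounds {v h : ℝ → ℝ} {L : ℝ}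
    (hv : ∀ ε, 0 < ε → HasDerivAt v (h ε) ε) (hh : ∀ ε, 0 < ε → ContinuousAt h ε)
    (hL : Tendsto h (𝓝[>] 0) (𝓝 L)) (hlow : ∀ ε, 0 < ε → v 0 + ε * h ε ≤ v ε)
    (hup : ∀ ε, 0 < ε → v ε ≤ v 0 + ε * L) :
    ContDiffOn ℝ 1 v (Ici 0) ∧ HasDerivWithinAt v L (Ici 0) 0 ∧
      (fun ε : ℝ => v ε - v 0 - ε * L) =o[𝓝[>] (0 : ℝ)] (fun ε : ℝ => ε) := by
  have ho : (fun ε : ℝ => v ε - v 0 - ε * L) =o[𝓝[>] (0 : ℝ)] (fun ε : ℝ => ε) := by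
    rw [isLittleO_iff]
    intro δ hδ
    filter_upwards [self_mem_nhdsWithin, Metric.tendsto_nhds.1 hL δ hδ] with ε hε hd
    have hε : 0 < ε := hε
    have h1 := hlow ε hε
    have h2 := hup ε hε
    rw [Real.dist_eq, abs_lt] at hd
    rw [Real.norm_eq_abs, Real.norm_eq_abs, abs_of_pos hε, abs_le]
    constructor <;> nlinarith
  have h0 : HasDerivWithinAt v L (Ici 0) 0 := by
    rw [← hasDerivWithinAt_Ioi_iff_Ici, hasDerivWithinAt_iff_isLittleO]
    simpa using ho
  refine ⟨?_, h0, ho⟩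
  have hderiv0 : derivWithin v (Ici 0) 0 = L := h0.derivWithin (uniqueDiffOn_Ici 0 0 self_mem_Ici)
  have hderiv : ∀ ε, 0 < ε → derivWithin v (Ici 0) ε = h ε := fun ε hε =>
    (hv ε hε).hasDerivWithinAt.derivWithin (uniqueDiffOn_Ici 0 ε hε.le)
  rw [contDiffOn_one_iff_derivWithin (uniqueDiffOn_Ici 0)]
  refine ⟨fun ε hε => ?_, fun ε hε => ?_⟩
  · rcases (mem_Ici.1 hε).eq_or_lt with rfl | hε
    · exact h0.differentiableWithinAt
    · exact (hv ε hε).differentiableAt.differentiableWithinAt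
  · rcases (mem_Ici.1 hε).eq_or_lt with rfl | hε
    · rw [← continuousWithinAt_Ioi_iff_Ici, ContinuousWithinAt, hderiv0]
      refine hL.congr' ?_
      filter_upwards [self_mem_nhdsWithin] with t ht using (hderiv t ht).symm
    · refine ContinuousAt.continuousWithinAt ((hh ε hε).congr ?_)
      filter_upwards [lt_mem_nhds hε] with t ht using (hderiv t ht).symm

theorem mainTheorem3 {d : ℕ} (μ ν : Measure (EuclideanSpace ℝ (Fin d)))
    [IsProbabilityMeasure μ] [IsProbabilityMeasure ν]
    (hμ : IsCompact μ.support) (hν : IsCompact ν.support)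
    (c : EuclideanSpace ℝ (Fin d) × EuclideanSpace ℝ (Fin d) → ℝ)
    (hc : ContinuousOn c (μ.support ×ˢ ν.support)) :
    -- the values are finite, so that `entropicCost` is the infimum itself
    (∀ ε : ℝ, 0 ≤ ε →
      EntropicOT.entropicInf μ ν c ε = (EntropicOT.entropicCost μ ν c ε : EReal)) ∧
    ∃ γ : ℝ → ProbabilityMeasure (EuclideanSpace ℝ (Fin d) × EuclideanSpace ℝ (Fin d)),
      -- `γ ε` is the unique optimal entropic plan
      (∀ ε : ℝ, 0 < ε → EntropicOT.entropicPlans μ ν c ε = {γ ε}) ∧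
      (∀ ε : ℝ, 0 < ε → EntropicOT.ent μ ν (γ ε) ≠ ∞ ∧
        HasDerivAt (EntropicOT.entropicCost μ ν c) (EntropicOT.ent μ ν (γ ε)).toReal ε) ∧
      ((∃ γ₀ ∈ EntropicOT.optimalPlans μ ν c, EntropicOT.ent μ ν γ₀ < ∞) →
        ContDiffOn ℝ 1 (EntropicOT.entropicCost μ ν c) (Ici 0) ∧
        EntropicOT.minEnt μ ν c ≠ ∞ ∧
        HasDerivWithinAt (EntropicOT.entropicCost μ ν c) (EntropicOT.minEnt μ ν c).toReal
          (Ici 0) 0 ∧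
        (fun ε : ℝ => EntropicOT.entropicCost μ ν c ε - EntropicOT.entropicCost μ ν c 0
          - ε * (EntropicOT.minEnt μ ν c).toReal) =o[𝓝[>] (0 : ℝ)] (fun ε : ℝ => ε) ∧
        ∃ γs : ProbabilityMeasure (EuclideanSpace ℝ (Fin d) × EuclideanSpace ℝ (Fin d)),
          -- `γs` is the unique entropy minimizer among the optimal plans
          {γ' | γ' ∈ EntropicOT.optimalPlans μ ν c ∧
            IsMinOn (EntropicOT.ent μ ν) (EntropicOT.optimalPlans μ ν c) γ'} = {γs} ∧
          Tendsto γ (𝓝[>] (0 : ℝ)) (𝓝 γs)) := by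
  open EntropicOT in
  obtain ⟨M₀, hM₀⟩ := (hμ.prod hν).exists_bound_of_continuousOn hc
  have hM : ∀ p ∈ μ.support ×ˢ ν.support, |c p| ≤ max M₀ 0 := fun p hp =>
    (hM₀ p hp).trans (le_max_left _ _)
  have hM0 : 0 ≤ max M₀ 0 := le_max_right _ _
  have P := perturbedProblem hc hM0 hM
  have hex : ∀ ε : ℝ, ∃ g ∈ finiteCouplings μ ν, 0 < ε → ∀ γ ∈ finiteCouplings μ ν,
      transportCost μ ν c g + ε * (ent μ ν g).toReal ≤
        transportCost μ ν c γ + ε * (ent μ ν γ).toReal := by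
    intro ε
    by_cases hε : 0 < ε
    · obtain ⟨g, hg, hmin⟩ := P.exists_minimizer hε
      exact ⟨g, hg, fun _ => hmin⟩
    · obtain ⟨g, hg, -⟩ := prod_mem_finiteCouplings μ ν
      exact ⟨g, hg, fun h => absurd h hε⟩
  choose g hgK' hg using hex
  have hgK : ∀ ε, 0 < ε → g ε ∈ finiteCouplings μ ν := fun ε _ => hgK' ε
  have hcost : ∀ ε, 0 < ε → entropicCost μ ν c ε =
      transportCost μ ν c (g ε) + ε * (ent μ ν (g ε)).toReal := fun ε hε => by
    rw [entropicCost, entropicInf_eq_coe hε (hgK ε hε) (hg ε hε), EReal.toReal_coe]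
  have hderiv : ∀ ε, 0 < ε →
      HasDerivAt (entropicCost μ ν c) (ent μ ν (g ε)).toReal ε := fun ε hε => by
    refine (P.hasDerivAt_value hgK hg hε).congr_of_eventuallyEq ?_
    filter_upwards [lt_mem_nhds hε] with t ht using hcost t ht
  refine ⟨fun ε hε => ?_, g, fun ε hε => entropicPlans_eq_singleton P hε (hgK ε hε) (hg ε hε),
    fun ε hε => ⟨(hgK ε hε).2, hderiv ε hε⟩, ?_⟩
  · rcases hε.eq_or_lt with rfl | hε
    -- At `ε = 0` the value is finite because costs are uniformly bounded; no optimal plan is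
    -- needed.
    · obtain ⟨γ, hγ, -⟩ := prod_mem_finiteCouplings μ ν
      refine (EReal.coe_toReal (ne_top_of_le_ne_top (EReal.coe_ne_top _)
        ((iInf₂_le γ hγ.1).trans_eq (entropicFunctional_zero μ ν c γ))) ?_).symm
      refine ne_bot_of_le_ne_bot (EReal.coe_ne_bot (-max M₀ 0)) (le_iInf₂ fun σ _ => ?_)
      rw [entropicFunctional_zero]
      exact EReal.coe_le_coe (abs_le.1 (abs_transportCost_le hM0 hM σ)).1
    · rw [hcost ε hε, entropicInf_eq_coe hε (hgK ε hε) (hg ε hε)]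
  rintro ⟨γ₀, hγ₀, hγ₀e⟩
  obtain ⟨γs, hγs, hTs, hmins, hlim, hHlim⟩ := P.exists_limit_zero hgK hg ⟨hγ₀.1, hγ₀e.ne⟩
    (fun γ hγ => hγ₀.2 hγ.1)
  have hopt : γs ∈ optimalPlans μ ν c := by
    refine ⟨hγs.1, isMinOn_iff.2 fun γ hγ => ?_⟩
    rw [hTs]
    exact hγ₀.2 hγ
  have hTopt : ∀ γ ∈ optimalPlans μ ν c, transportCost μ ν c γ = transportCost μ ν c γ₀ :=
    fun γ hγ => le_antisymm (hγ.2 hγ₀.1) (hγ₀.2 hγ.1)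
  have hentmin : ∀ γ ∈ optimalPlans μ ν c, ent μ ν γs ≤ ent μ ν γ := by
    intro γ hγ
    by_cases h : ent μ ν γ = ∞
    · rw [h]; exact le_top
    · exact (ENNReal.toReal_le_toReal hγs.2 h).1 (hmins γ ⟨hγ.1, h⟩ (hTopt γ hγ)).1
  have hminEnt : minEnt μ ν c = ent μ ν γs :=
    le_antisymm (iInf₂_le γs hopt) (le_iInf₂ hentmin)
  have hcost0 : entropicCost μ ν c 0 = transportCost μ ν c γs := by
    rw [entropicCost, entropicInf_zero_eq_coe hopt, EReal.toReal_coe]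
  -- The lower bound holds because `γs` has least cost, the upper one because `γs` is a competitor
  -- at `ε`.
  obtain ⟨h1, h2, h3⟩ := contDiffOn_Ici_of_slope_bounds hderiv
    (fun ε hε => P.continuousAt_entropy hgK hg hε) hHlim
    (fun ε hε => by
      rw [hcost ε hε, hcost0]
      gcongr
      exact hopt.2 (hgK ε hε).1)
    (fun ε hε => by
      rw [hcost ε hε, hcost0]
      exact hg ε hε γs hγs)
  rw [hminEnt]
  refine ⟨h1, hγs.2, h2, h3, γs, ?_,
    tendsto_of_tendsto_densityL1 (.of_forall hgK') hγs hlim⟩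
  ext γ
  rw [mem_singleton_iff]
  constructor
  · rintro ⟨hγ, hγmin⟩
    have hle : ent μ ν γ ≤ ent μ ν γs := hγmin hopt
    have hfin : ent μ ν γ ≠ ∞ := ne_top_of_le_ne_top hγs.2 hle
    exact (hmins γ ⟨hγ.1, hfin⟩ (hTopt γ hγ)).2 (ENNReal.toReal_mono hγs.2 hle)
  · rintro rfl
    exact ⟨hopt, hentmin⟩
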